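/- Let $\mu,\lambda>0$ and let $\mathrm{IG}(\mu,\lambda)$ be the inverse Gaussian distribution with density $$\phi(x)=\sqrt{\tfrac{\lambda}{2\pi}}\,e^{\lambda/\mu}\,x^{-3/2}\exp\Big(-\tfrac{\lambda}{2\mu}\big(\tfrac{x}{\mu}+\tfrac{\mu}{x}\big)\Big)\quad\text{for }x>0,\text{ and }0\text{ otherwise}.$$ Let $f:(0,\infty)\to\mathbb{R}$ be differentiable and, for $X\sim\mathrm{IG}(\mu,\lambda)$ and $k,l,m\in\mathbb{N}_0$, write $\mu_f(k,l,m)=\mathbb{E}[X^k f(X)^l f'(X)^m]$. Assume that the second moments $\mu_f(0,2,0)$, $\mu_f(4,2,0)$ and $\mu_f(4,0,2)$ are finite. Let $X_1,X_2,\ldots$ be i.i.d. with distribution $\mathrm{IG}(\mu,\lambda)$ and put $$Z_i=\big(X_i,\ f(X_i),\ X_if(X_i),\ X_i^2f(X_i),\ X_i^2f'(X_i)\big)^\top,\qquad \overline{Z}=\frac1n\sum_{i=1}^n Z_i .$$ Then the $Z_i$ are square integrable, with mean $$\mu_Z=\mathbb{E}[Z_i]=\big(\mu,\ \mu_f(0,1,0),\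 \mu_f(1,1,0),\ \mu_f(2,1,0),\ \mu_f(2,0,1)\big)^\top$$ and (positive semidefinite) covariance matrix $\Sigma=(\sigma_{ij})_{i,j=1,\ldots,5}$, and $$\sqrt{n}\,\big(\overline{Z}-\mu_Z\big)\ \xrightarrow{d}\ \mathrm{N}(0,\Sigma)\qquad(n\to\infty),$$ where $\mathrm{N}(0,\Sigma)$ is the (possibly degenerate) multivariate normal distribution and $\Sigma$ is symmetric with \begin{align*} \sigma_{11}&=\mu^3/\lambda, & \sigma_{23}&=\mu_f(1,2,0)-\mu_f(0,1,0)\,\mu_f(1,1,0),\\ \sigma_{12}&=\mu_f(1,1,0)-\mu\,\mu_f(0,1,0), & \sigma_{24}&=\mu_f(2,2,0)-\mu_f(0,1,0)\,\mu_f(2,1,0),\\ \sigma_{13}&=\mu_f(2,1,0)-\mu\,\mu_f(1,1,0), & \sigma_{25}&=\mu_f(2,1,1)-\mu_f(0,1,0)\,\mu_f(2,0,1),\\ \sigma_{14}&=\mu_f(3,1,0)-\mu\,\mu_f(2,1,0), & \sigma_{34}&=\mu_f(3,2,0)-\mu_f(1,1,0)\,\mu_f(2,1,0),\\ \sigma_{15}&=\mu_f(3,0,1)-\mu\,\mu_f(2,0,1),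 & \sigma_{35}&=\mu_f(3,1,1)-\mu_f(1,1,0)\,\mu_f(2,0,1),\\ \sigma_{22}&=\mu_f(0,2,0)-\mu_f(0,1,0)^2, & \sigma_{45}&=\mu_f(4,1,1)-\mu_f(2,1,0)\,\mu_f(2,0,1),\\ \sigma_{33}&=\mu_f(2,2,0)-\mu_f(1,1,0)^2, & \sigma_{55}&=\mu_f(4,0,2)-\mu_f(2,0,1)^2,\\ \sigma_{44}&=\mu_f(4,2,0)-\mu_f(2,1,0)^2. && \end{align*} -/

import Mathlib

open MeasureTheory ProbabilityTheory Filter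

namespace SteinIG

/-- Density of the inverse Gaussian distribution with mean `μ` and shape `lam`. -/
noncomputable def igPDFReal (μ lam x : ℝ) : ℝ :=
  if 0 < x then
    Real.sqrt (lam / (2 * Real.pi)) * Real.exp (lam / μ) * x ^ (-(3 / 2) : ℝ) *
      Real.exp (-(lam / (2 * μ)) * (x / μ + μ / x))
  else 0

/-- The inverse Gaussian distribution `IG(μ, lam)` on the real line. -/
noncomputable def igMeasure (μ lam : ℝ) : Measure ℝ :=
  volume.withDensity fun x => ENNReal.ofReal (igPDFReal μ lam x)

/-- The moment `μ_f(k,l,m) = E[X ^ k * f(X) ^ l * f'(X) ^ m]` for `X ∼ IG(μ, lam)`. -/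
noncomputable def moment (μ lam : ℝ) (f : ℝ → ℝ) (k l m : ℕ) : ℝ :=
  ∫ x, x ^ k * f x ^ l * deriv f x ^ m ∂(igMeasure μ lam)

/-- The vector `(x, f(x), x f(x), x² f(x), x² f'(x))`. -/
noncomputable def zVec (f : ℝ → ℝ) (x : ℝ) : EuclideanSpace ℝ (Fin 5) :=
  !₂[x, f x, x * f x, x ^ 2 * f x, x ^ 2 * deriv f x]

/-- The vector `(μ, μ_f(0,1,0), μ_f(1,1,0), μ_f(2,1,0), μ_f(2,0,1))`. -/
noncomputable def meanVec (μ lam : ℝ) (f : ℝ → ℝ) : EuclideanSpace ℝ (Fin 5) :=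
  !₂[μ, moment μ lam f 0 1 0, moment μ lam f 1 1 0, moment μ lam f 2 1 0, moment μ lam f 2 0 1]

/-- The symmetric matrix `Σ = (σ_ij)` of the asymptotic covariances. -/
noncomputable def covMat (μ lam : ℝ) (f : ℝ → ℝ) : Matrix (Fin 5) (Fin 5) ℝ :=
  let M := moment μ lam f
  let s11 := μ ^ 3 / lam
  let s12 := M 1 1 0 - μ * M 0 1 0
  let s13 := M 2 1 0 - μ * M 1 1 0
  let s14 := M 3 1 0 - μ * M 2 1 0
  let s15 := M 3 0 1 - μ * M 2 0 1
  let s22 := M 0 2 0 - M 0 1 0 ^ 2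
  let s23 := M 1 2 0 - M 0 1 0 * M 1 1 0
  let s24 := M 2 2 0 - M 0 1 0 * M 2 1 0
  let s25 := M 2 1 1 - M 0 1 0 * M 2 0 1
  let s33 := M 2 2 0 - M 1 1 0 ^ 2
  let s34 := M 3 2 0 - M 1 1 0 * M 2 1 0
  let s35 := M 3 1 1 - M 1 1 0 * M 2 0 1
  let s44 := M 4 2 0 - M 2 1 0 ^ 2
  let s45 := M 4 1 1 - M 2 1 0 * M 2 0 1
  let s55 := M 4 0 2 - M 2 0 1 ^ 2
  !![s11, s12, s13, s14, s15;
     s12, s22, s23, s24, s25;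
     s13, s23, s33, s34, s35;
     s14, s24, s34, s44, s45;
     s15, s25, s35, s45, s55]

end SteinIG

/-! The limit law is the Cramér–Wold argument carried out on characteristic functions: each
projection `⟪t, Z i⟫` obeys the scalar central limit theorem, its variance is the quadratic form of
the covariance matrix at `t`, and the scalar characteristic functions at `1` are the vector ones at
`t`. Degenerate covariance is therefore harmless. What is specific to the inverse Gaussian is the
closed form of `E[X]` and `E[X²]`; the other entries are moments by definition. The mean follows
from total mass one under the inversion `x ↦ μ² / x` (`igPDFReal_inversion`), the second moment from
integrating the derivative of density times `x²` (`hasDerivAt_igPDFReal_mul_sq`). -/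

namespace SteinIG

/-! ### Multivariate central limit theorem -/

section CentralLimit

open scoped RealInnerProductSpace Matrix Topology

variable {ι Ω : Type*} [Fintype ι] {mΩ : MeasurableSpace Ω} {P : Measure Ω}

/-- The variance of `⟪t, Z⟫` is the quadratic form of the covariance matrix of `Z` at `t`. -/
theorem variance_inner_eq_dotProduct [IsFiniteMeasure P] {Z : Ω → EuclideanSpace ℝ ι}
    (hZ : MemLp Z 2 P) {S : Matrix ι ι ℝ}
    (hS : ∀ a b, cov[fun ω => Z ω a, fun ω => Z ω b; P] = S a b) (t : EuclideanSpace ℝ ι) :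
    Var[fun ω => ⟪t, Z ω⟫; P] = t ⬝ᵥ S *ᵥ t := by
  have hc (i : ι) : MemLp (fun ω => t i * Z ω i) 2 P := (hZ.eval_piLp i).const_mul _
  have h : (fun ω => ⟪t, Z ω⟫) = fun ω => ∑ i, t i * Z ω i := by
    ext ω
    simp [PiLp.inner_apply, mul_comm]
  rw [h, variance_fun_sum hc]
  simp_rw [covariance_const_mul_left, covariance_const_mul_right, hS, dotProduct, Matrix.mulVec,
    dotProduct, Finset.mul_sum]
  refine Finset.sum_congr rfl fun i _ => Finset.sum_congr rfl fun j _ => ?_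
  ring

/-- The covariance matrix of a square integrable random vector is positive semidefinite. -/
theorem posSemidef_of_covariance_eq [IsFiniteMeasure P] {Z : Ω → EuclideanSpace ℝ ι}
    (hZ : MemLp Z 2 P) {S : Matrix ι ι ℝ}
    (hS : ∀ a b, cov[fun ω => Z ω a, fun ω => Z ω b; P] = S a b) : S.PosSemidef := by
  refine Matrix.PosSemidef.of_dotProduct_mulVec_nonneg ?_ fun x => ?_
  · ext i j
    simp [← hS, covariance_comm]
  · have h := variance_inner_eq_dotProduct hZ hS (WithLp.toLp 2 x)
    simp [← h, variance_nonneg]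

/-- **Multivariate central limit theorem** for i.i.d. square integrable random vectors. -/
theorem tendstoInDistribution_multivariateGaussian [DecidableEq ι] [IsProbabilityMeasure P]
    {Z : ℕ → Ω → EuclideanSpace ℝ ι} (hZ : MemLp (Z 0) 2 P) (hindep : iIndepFun Z P)
    (hident : ∀ i, IdentDistrib (Z i) (Z 0) P P) {S : Matrix ι ι ℝ}
    (hS : ∀ a b, cov[fun ω => Z 0 ω a, fun ω => Z 0 ω b; P] = S a b) :
    TendstoInDistribution
      (fun (n : ℕ) ω => (√n)⁻¹ • (∑ k ∈ Finset.range n, Z k ω - (n : ℝ) • P[Z 0])) atTop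
      (id : EuclideanSpace ℝ ι → EuclideanSpace ℝ ι) (fun _ => P) (multivariateGaussian 0 S) where
  forall_aemeasurable n :=
    ((Finset.aemeasurable_fun_sum _ fun k _ =>
      (hident k).aemeasurable_fst).sub_const _).fun_const_smul _
  tendsto := by
    have hpos := posSemidef_of_covariance_eq hZ hS
    refine ProbabilityMeasure.tendsto_iff_tendsto_charFun.2 fun t => ?_
    have hm : Measurable fun z : EuclideanSpace ℝ ι => ⟪t, z⟫ := by fun_prop
    have hW : MemLp (fun ω => ⟪t, Z 0 ω⟫) 2 P := hZ.const_inner t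
    have hmean : ∫ ω, ⟪t, Z 0 ω⟫ ∂P = ⟪t, P[Z 0]⟫ :=
      integral_inner (hZ.integrable (by norm_num)) t
    have clt := (tendstoInDistribution_inv_sqrt_mul_sum_sub
      (P' := gaussianReal 0 Var[fun ω => ⟪t, Z 0 ω⟫; P].toNNReal)
      (X := fun i ω => ⟪t, Z i ω⟫) HasLaw.id hW (hindep.comp (fun _ z => ⟪t, z⟫) fun _ => hm)
      fun i => (hident i).comp hm)
    have key := ProbabilityMeasure.tendsto_iff_tendsto_charFun.1 clt.tendsto 1
    have hsum : ∀ n : ℕ, AEMeasurable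
        (fun ω => (√n)⁻¹ • (∑ k ∈ Finset.range n, Z k ω - (n : ℝ) • P[Z 0])) P := fun n =>
      ((Finset.aemeasurable_fun_sum _ fun k _ =>
        (hident k).aemeasurable_fst).sub_const _).fun_const_smul _
    convert! key using 1
    · ext n
      simp only [ProbabilityMeasure.coe_mk]
      rw [charFun_apply, charFun_apply, integral_map (hsum n) (by fun_prop),
        integral_map (clt.forall_aemeasurable n) (by fun_prop)]
      simp [hmean, inner_smul_left, inner_sub_left, sum_inner, real_inner_comm]
    · simp only [ProbabilityMeasure.coe_mk, Measure.map_id]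
      rw [charFun_multivariateGaussian hpos, charFun_gaussianReal,
        Real.coe_toNNReal _ (variance_nonneg _ _), variance_inner_eq_dotProduct hZ hS]
      simp

end CentralLimit

/-! ### Moments of the inverse Gaussian law -/

section InverseGaussian

open Set
open scoped Topology

variable {μ lam : ℝ}

theorem igPDFReal_of_pos {x : ℝ} (hx : 0 < x) :
    igPDFReal μ lam x = √(lam / (2 * Real.pi)) * Real.exp (lam / μ) * x ^ (-(3 / 2) : ℝ) *
      Real.exp (-(lam / (2 * μ)) * (x / μ + μ / x)) :=
  if_pos hx

theorem igPDFReal_of_nonpos {x : ℝ} (hx : x ≤ 0) : igPDFReal μ lam x = 0 :=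
  if_neg hx.not_gt

theorem igPDFReal_nonneg (x : ℝ) : 0 ≤ igPDFReal μ lam x := by
  rcases lt_or_ge 0 x with hx | hx
  · rw [igPDFReal_of_pos hx]
    positivity
  · rw [igPDFReal_of_nonpos hx]

@[fun_prop]
theorem measurable_igPDFReal : Measurable (igPDFReal μ lam) := by
  unfold igPDFReal
  exact Measurable.ite measurableSet_Ioi (by fun_prop) measurable_const

/-- An inverse Gaussian variable is almost surely positive. -/
theorem ae_pos_igMeasure : ∀ᵐ x ∂(igMeasure μ lam), 0 < x := by
  rw [igMeasure, ae_withDensity_iff (by fun_prop)]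
  refine ae_of_all _ fun x hx => ?_
  by_contra h
  simp [igPDFReal_of_nonpos (not_lt.1 h)] at hx

/-- Lets continuity of `f` on the half-line alone yield measurability, whatever `f` is elsewhere. -/
theorem igMeasure_absolutelyContinuous : igMeasure μ lam ≪ volume.restrict (Ioi 0) := by
  have h : (igMeasure μ lam).restrict (Ioi 0) = igMeasure μ lam :=
    Measure.restrict_eq_self_of_ae_mem ae_pos_igMeasure
  rw [← h]
  exact (withDensity_absolutelyContinuous _ _).restrict _

theorem integral_igMeasure (g : ℝ → ℝ) :
    ∫ x, g x ∂(igMeasure μ lam) = ∫ x in Ioi 0, igPDFReal μ lam x * g x := by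
  rw [igMeasure, integral_withDensity_eq_integral_toReal_smul (by fun_prop)
    (ae_of_all _ fun _ => ENNReal.ofReal_lt_top)]
  simp_rw [ENNReal.toReal_ofReal (igPDFReal_nonneg _), smul_eq_mul]
  refine (setIntegral_eq_integral_of_forall_compl_eq_zero fun x hx => ?_).symm
  rw [igPDFReal_of_nonpos (not_lt.1 hx), zero_mul]

theorem integrable_igMeasure_iff {g : ℝ → ℝ} :
    Integrable g (igMeasure μ lam) ↔ IntegrableOn (fun x => igPDFReal μ lam x * g x) (Ioi 0) := by
  rw [igMeasure, integrable_withDensity_iff_integrable_smul' (by fun_prop)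
    (ae_of_all _ fun _ => ENNReal.ofReal_lt_top)]
  simp_rw [ENNReal.toReal_ofReal (igPDFReal_nonneg _), smul_eq_mul]
  refine (integrableOn_iff_integrable_of_support_subset fun x hx => ?_).symm
  by_contra h
  exact hx (by simp [igPDFReal_of_nonpos (not_lt.1 h)])

/-- Dropping the factor `exp (-lam / (2 * x)) ≤ 1` leaves a Gamma-type integrand, which serves both
for integrability and for boundary limits. -/
theorem igPDFReal_mul_pow_le (hμ : 0 < μ) (hlam : 0 < lam) {x : ℝ} (hx : 0 < x) (k : ℕ) :
    igPDFReal μ lam x * x ^ k ≤ √(lam / (2 * Real.pi)) * Real.exp (lam / μ) *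
      (x ^ (k - 3 / 2 : ℝ) * Real.exp (-(lam / (2 * μ ^ 2)) * x)) := by
  have h : x ^ (k - 3 / 2 : ℝ) = x ^ (-(3 / 2) : ℝ) * x ^ k := by
    rw [← Real.rpow_natCast x k, ← Real.rpow_add hx]
    ring_nf
  rw [igPDFReal_of_pos hx, h]
  have hexp : Real.exp (-(lam / (2 * μ)) * (x / μ + μ / x)) ≤
      Real.exp (-(lam / (2 * μ ^ 2)) * x) := by
    refine Real.exp_le_exp.2 ?_
    have h1 : -(lam / (2 * μ)) * (x / μ + μ / x) = -(lam / (2 * μ ^ 2)) * x - lam / (2 * x) := by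
      field_simp
      ring
    rw [h1]
    linarith [show 0 ≤ lam / (2 * x) by positivity]
  calc _ = √(lam / (2 * Real.pi)) * Real.exp (lam / μ) * (x ^ (-(3 / 2) : ℝ) * x ^ k *
        Real.exp (-(lam / (2 * μ)) * (x / μ + μ / x))) := by ring
    _ ≤ _ := by gcongr

theorem integrable_pow_igMeasure (hμ : 0 < μ) (hlam : 0 < lam) {k : ℕ} (hk : 1 ≤ k) :
    Integrable (fun x => x ^ k) (igMeasure μ lam) := by
  rw [integrable_igMeasure_iff]
  -- The dominating power `k - 3 / 2` must exceed `-1` to be integrable at `0`.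
  have hk' : (1 : ℝ) ≤ k := by exact_mod_cast hk
  have h := (integrableOn_rpow_mul_exp_neg_mul_rpow (p := 1) (s := k - 3 / 2)
    (b := lam / (2 * μ ^ 2)) (by linarith) one_pos (by positivity)).const_mul
    (√(lam / (2 * Real.pi)) * Real.exp (lam / μ))
  refine Integrable.mono' h (by fun_prop) ?_
  filter_upwards [ae_restrict_mem measurableSet_Ioi] with x hx
  rw [Real.norm_of_nonneg (mul_nonneg (igPDFReal_nonneg _) (pow_nonneg (le_of_lt hx) _)),
    Real.rpow_one]
  exact igPDFReal_mul_pow_le hμ hlam hx k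

/-- The density under the inversion `x ↦ μ ^ 2 / x`, which preserves `x / μ + μ / x`. -/
theorem igPDFReal_inversion (hμ : 0 < μ) {x : ℝ} (hx : 0 < x) :
    μ ^ 2 / x ^ 2 * igPDFReal μ lam (μ ^ 2 / x) = igPDFReal μ lam x * x / μ := by
  rw [igPDFReal_of_pos (by positivity), igPDFReal_of_pos hx,
    Real.div_rpow (by positivity) hx.le, Real.rpow_neg hx.le, ← Real.rpow_natCast μ 2,
    ← Real.rpow_mul hμ.le]
  have h1 : μ ^ (((2 : ℕ) : ℝ) * -(3 / 2)) = (μ ^ 3)⁻¹ := by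
    rw [← Real.rpow_natCast μ 3, ← Real.rpow_neg hμ.le]
    norm_num
  have h2 : x ^ (3 / 2 : ℝ) * x ^ (3 / 2 : ℝ) = x ^ 3 := by
    rw [← Real.rpow_add hx, ← Real.rpow_natCast x 3]
    norm_num
  have h3 : μ ^ 2 / x / μ + μ / (μ ^ 2 / x) = x / μ + μ / x := by
    field_simp
    ring
  have h4 : 0 < x ^ (3 / 2 : ℝ) := Real.rpow_pos_of_pos hx _
  rw [h1, Real.rpow_natCast μ 2, h3]
  field_simp
  rw [sq, h2, mul_comm]

/-- The mean of the inverse Gaussian distribution. -/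
theorem integral_id_igMeasure (hμ : 0 < μ) [IsProbabilityMeasure (igMeasure μ lam)] :
    ∫ x, x ∂(igMeasure μ lam) = μ := by
  have hmass : ∫ x in Ioi 0, igPDFReal μ lam x = 1 := by
    have h := integral_igMeasure (μ := μ) (lam := lam) fun _ => 1
    simpa using h.symm
  have himage : (fun x : ℝ => μ ^ 2 / x) '' Ioi 0 = Ioi 0 := by
    ext y
    refine ⟨?_, fun hy => ⟨μ ^ 2 / y, ?_, ?_⟩⟩
    · rintro ⟨x, hx, rfl⟩
      have : 0 < x := hx
      exact mem_Ioi.2 (by positivity)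
    · have : 0 < y := hy
      exact mem_Ioi.2 (by positivity)
    · have : 0 < y := hy
      simp only
      field_simp
  have hderiv : ∀ x ∈ Ioi (0 : ℝ),
      HasDerivWithinAt (fun x : ℝ => μ ^ 2 / x) (-(μ ^ 2 / x ^ 2)) (Ioi 0) x := fun x hx => by
    have h := ((hasDerivAt_inv (ne_of_gt hx)).const_mul (μ ^ 2)).hasDerivWithinAt (s := Ioi 0)
    simpa [div_eq_mul_inv] using h
  have hinj : InjOn (fun x : ℝ => μ ^ 2 / x) (Ioi 0) := fun x hx y hy hxy => by
    have hx' : x ≠ 0 := ne_of_gt hx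
    have hy' : y ≠ 0 := ne_of_gt hy
    simp only at hxy
    field_simp at hxy
    exact hxy.symm
  -- Inverting the variable in the total mass turns it into `E[X] / μ`.
  have h := integral_image_eq_integral_abs_deriv_smul measurableSet_Ioi hderiv hinj
    (igPDFReal μ lam)
  rw [himage, hmass] at h
  have h2 : ∫ x in Ioi 0, |-(μ ^ 2 / x ^ 2)| • igPDFReal μ lam (μ ^ 2 / x) =
      ∫ x in Ioi 0, igPDFReal μ lam x * x / μ := by
    refine setIntegral_congr_fun measurableSet_Ioi fun x hx => ?_
    simp only [abs_neg, smul_eq_mul]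
    rw [abs_of_nonneg (by positivity), igPDFReal_inversion hμ hx]
  rw [h2, integral_div, ← integral_igMeasure fun x => x] at h
  field_simp at h
  exact h.symm

/-- The logarithmic derivative of the density has a pole of order two at `0`; the weight `x²` clears
it, so integration gives a linear relation between `1`, `E[X]` and `E[X²]`. -/
theorem hasDerivAt_igPDFReal_mul_sq (hμ : 0 < μ) {x : ℝ} (hx : 0 < x) :
    HasDerivAt (fun x => igPDFReal μ lam x * x ^ 2)
      (igPDFReal μ lam x * (x / 2 - lam / (2 * μ ^ 2) * x ^ 2 + lam / 2)) x := by
  have hpow := Real.hasDerivAt_rpow_const (x := x) (p := -(3 / 2)) (Or.inl hx.ne')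
  have hexp := ((((hasDerivAt_id x).div_const μ).add
    ((hasDerivAt_inv hx.ne').const_mul μ)).const_mul (-(lam / (2 * μ)))).exp
  have h := ((hpow.const_mul (√(lam / (2 * Real.pi)) * Real.exp (lam / μ))).mul hexp).mul
    (hasDerivAt_pow 2 x)
  refine (h.congr_deriv ?_).congr_of_eventuallyEq ?_
  · have h1 : x ^ (-(3 / 2) - 1 : ℝ) = x ^ (-(3 / 2) : ℝ) / x := Real.rpow_sub_one hx.ne' _
    rw [igPDFReal_of_pos hx, h1]
    simp only [Pi.add_apply, id, ← div_eq_mul_inv, Pi.mul_apply]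
    generalize Real.exp (-(lam / (2 * μ)) * (x / μ + μ / x)) = e
    field_simp
    ring
  · filter_upwards [Ioi_mem_nhds hx] with y hy
    rw [igPDFReal_of_pos hy]
    simp [div_eq_mul_inv]

/-- The second moment of the inverse Gaussian distribution. -/
theorem integral_sq_igMeasure (hμ : 0 < μ) (hlam : 0 < lam)
    [IsProbabilityMeasure (igMeasure μ lam)] :
    ∫ x, x ^ 2 ∂(igMeasure μ lam) = μ ^ 2 + μ ^ 3 / lam := by
  have hi1 : Integrable (fun x : ℝ => x / 2) (igMeasure μ lam) := by
    simpa using (integrable_pow_igMeasure hμ hlam le_rfl).div_const 2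
  have hi2 : Integrable (fun x : ℝ => lam / (2 * μ ^ 2) * x ^ 2) (igMeasure μ lam) :=
    (integrable_pow_igMeasure hμ hlam one_le_two).const_mul _
  have hi12 : Integrable (fun x : ℝ => x / 2 - lam / (2 * μ ^ 2) * x ^ 2) (igMeasure μ lam) :=
    hi1.sub hi2
  have hi : Integrable (fun x : ℝ => x / 2 - lam / (2 * μ ^ 2) * x ^ 2 + lam / 2)
      (igMeasure μ lam) := hi12.add (integrable_const _)
  -- One bound covers both ends of the half-line, since the exponent `2 - 3 / 2` is positive.
  have hlim (l : Filter ℝ) (hl : ∀ᶠ x in l, 0 ≤ x) (hl0 : Tendsto (fun x : ℝ =>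
      √(lam / (2 * Real.pi)) * Real.exp (lam / μ) *
        (x ^ (1 / 2 : ℝ) * Real.exp (-(lam / (2 * μ ^ 2)) * x))) l (𝓝 0)) :
      Tendsto (fun x => igPDFReal μ lam x * x ^ 2) l (𝓝 0) := by
    refine squeeze_zero' (Eventually.of_forall fun x =>
      mul_nonneg (igPDFReal_nonneg x) (sq_nonneg x)) ?_ hl0
    filter_upwards [hl] with x hx
    rcases hx.eq_or_lt with rfl | hx
    · simp
    · convert igPDFReal_mul_pow_le hμ hlam hx 2 using 4
      norm_num
  have h := integral_Ioi_of_hasDerivAt_of_tendsto (f := fun x => igPDFReal μ lam x * x ^ 2)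
    (a := 0) (m := 0) ?_ (fun x hx => hasDerivAt_igPDFReal_mul_sq hμ hx)
    (integrable_igMeasure_iff.1 hi) ?_
  · rw [← integral_igMeasure, integral_add hi12 (integrable_const _),
      integral_sub hi1 hi2, integral_div, integral_const_mul, integral_id_igMeasure hμ] at h
    simp only [integral_const, probReal_univ, smul_eq_mul] at h
    field_simp at h ⊢
    linarith
  · rw [ContinuousWithinAt]
    simp only [ne_eq, OfNat.ofNat_ne_zero, not_false_eq_true, zero_pow, mul_zero]
    refine hlim _ self_mem_nhdsWithin ?_
    have hc : ContinuousAt (fun x : ℝ => √(lam / (2 * Real.pi)) * Real.exp (lam / μ) *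
        (x ^ (1 / 2 : ℝ) * Real.exp (-(lam / (2 * μ ^ 2)) * x))) 0 :=
      ((Real.continuousAt_rpow_const _ _ (Or.inr (by norm_num))).mul (by fun_prop)).const_mul _
    have := hc.tendsto
    rw [Real.zero_rpow (by norm_num), zero_mul, mul_zero] at this
    exact this.mono_left nhdsWithin_le_nhds
  · refine hlim _ (eventually_ge_atTop 0) ?_
    simpa using (tendsto_rpow_mul_exp_neg_mul_atTop_nhds_zero (1 / 2) (lam / (2 * μ ^ 2))
      (by positivity)).const_mul (√(lam / (2 * Real.pi)) * Real.exp (lam / μ))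

end InverseGaussian

/-! ### Integrability and covariances of `zVec` -/

section ZVector

open Set
open scoped Topology

variable {μ lam : ℝ} {f : ℝ → ℝ}

theorem aestronglyMeasurable_igMeasure_of_continuousOn (hf : ContinuousOn f (Ioi 0)) :
    AEStronglyMeasurable f (igMeasure μ lam) :=
  (hf.aestronglyMeasurable measurableSet_Ioi).mono_ac igMeasure_absolutelyContinuous

/-- `zVec f` is square integrable under the inverse Gaussian distribution. -/
theorem memLp_zVec (hμ : 0 < μ) (hlam : 0 < lam) (hf : ContinuousOn f (Ioi 0))
    (h020 : Integrable (fun x => f x ^ 2) (igMeasure μ lam))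
    (h420 : Integrable (fun x => x ^ 4 * f x ^ 2) (igMeasure μ lam))
    (h402 : Integrable (fun x => x ^ 4 * deriv f x ^ 2) (igMeasure μ lam)) :
    MemLp (zVec f) 2 (igMeasure μ lam) := by
  have hm : AEStronglyMeasurable f (igMeasure μ lam) :=
    aestronglyMeasurable_igMeasure_of_continuousOn hf
  have hid : AEStronglyMeasurable (fun x : ℝ => x) (igMeasure μ lam) := by fun_prop
  have hd : AEStronglyMeasurable (deriv f) (igMeasure μ lam) := aestronglyMeasurable_deriv f _
  refine MemLp.of_eval_piLp fun i => ?_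
  fin_cases i
  · exact (memLp_two_iff_integrable_sq hid).2 (integrable_pow_igMeasure hμ hlam one_le_two)
  · exact (memLp_two_iff_integrable_sq hm).2 h020
  · refine (memLp_two_iff_integrable_sq (hid.mul hm)).2 ?_
    refine Integrable.mono' (h020.add h420) ((hid.mul hm).pow 2) (ae_of_all _ fun x => ?_)
    rw [Real.norm_of_nonneg (sq_nonneg _)]
    simp only [Pi.mul_apply, Pi.add_apply]
    -- This is `x² ≤ 1 + x⁴` multiplied by `f x ^ 2`.
    nlinarith [mul_nonneg (sq_nonneg (x ^ 2 - 1)) (sq_nonneg (f x)), sq_nonneg (x * f x)]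
  · refine (memLp_two_iff_integrable_sq ((hid.pow 2).mul hm)).2 (h420.congr (ae_of_all _ ?_))
    intro x
    simp only [Pi.mul_apply, Pi.pow_apply]
    ring
  · refine (memLp_two_iff_integrable_sq ((hid.pow 2).mul hd)).2 (h402.congr (ae_of_all _ ?_))
    intro x
    simp only [Pi.mul_apply, Pi.pow_apply]
    ring

theorem integral_zVec_apply (hμ : 0 < μ) [IsProbabilityMeasure (igMeasure μ lam)] (a : Fin 5) :
    ∫ x, zVec f x a ∂(igMeasure μ lam) = meanVec μ lam f a := by
  fin_cases a
  · exact integral_id_igMeasure hμ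
  all_goals simp [zVec, meanVec, moment]

theorem covariance_zVec (hμ : 0 < μ) (hlam : 0 < lam) [IsProbabilityMeasure (igMeasure μ lam)]
    (hZ : MemLp (zVec f) 2 (igMeasure μ lam)) (a b : Fin 5) :
    cov[fun x => zVec f x a, fun x => zVec f x b; igMeasure μ lam] = covMat μ lam f a b := by
  wlog hab : a ≤ b generalizing a b
  · rw [covariance_comm, this b a (le_of_not_ge hab)]
    clear this hab
    fin_cases a <;> fin_cases b <;> rfl
  rw [covariance_eq_sub (hZ.eval_piLp a) (hZ.eval_piLp b), integral_zVec_apply hμ,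
    integral_zVec_apply hμ]
  fin_cases a <;> fin_cases b <;> first | exact absurd hab (by decide) | skip
  -- Only the top-left entry needs an explicit second moment.
  · have h := integral_sq_igMeasure hμ hlam
    have h1 : ∫ x, ((fun x => zVec f x 0) * fun x => zVec f x 0) x ∂(igMeasure μ lam) =
        ∫ x, x ^ 2 ∂(igMeasure μ lam) := by
      simp [zVec, sq]
    change ∫ x, ((fun x => zVec f x 0) * fun x => zVec f x 0) x ∂(igMeasure μ lam) - μ * μ =
      μ ^ 3 / lam
    rw [h1, h]
    ring
  all_goals
    simp only [zVec, meanVec, covMat, moment, Pi.mul_apply]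
    simp only [Fin.mk_zero', Fin.mk_one, Fin.reduceFinMk, Matrix.of_apply, Matrix.cons_val,
      Fin.isValue, sq]
    congr 1
    refine integral_congr_ae (ae_of_all _ fun x => ?_)
    ring

end ZVector

end SteinIG

theorem mainTheorem5
    (μ lam : ℝ) (hμ : 0 < μ) (hlam : 0 < lam)
    (f : ℝ → ℝ) (hf : DifferentiableOn ℝ f (Set.Ioi 0))
    (h020 : Integrable (fun x => f x ^ 2) (SteinIG.igMeasure μ lam))
    (h420 : Integrable (fun x => x ^ 4 * f x ^ 2) (SteinIG.igMeasure μ lam))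
    (h402 : Integrable (fun x => x ^ 4 * deriv f x ^ 2) (SteinIG.igMeasure μ lam))
    {Ω : Type*} [MeasurableSpace Ω] (P : Measure Ω) [IsProbabilityMeasure P]
    (X : ℕ → Ω → ℝ)
    (hlaw : ∀ i, HasLaw (X i) (SteinIG.igMeasure μ lam) P)
    (hindep : iIndepFun X P) :
    (∀ i, MemLp (fun ω => SteinIG.zVec f (X i ω)) 2 P) ∧
    (∀ i, ∫ ω, SteinIG.zVec f (X i ω) ∂P = SteinIG.meanVec μ lam f) ∧
    (∀ i a b, cov[fun ω => SteinIG.zVec f (X i ω) a, fun ω => SteinIG.zVec f (X i ω) b; P]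
      = SteinIG.covMat μ lam f a b) ∧
    (SteinIG.covMat μ lam f).PosSemidef ∧
    TendstoInDistribution
      (fun (n : ℕ) (ω : Ω) =>
        Real.sqrt n • ((n : ℝ)⁻¹ • (∑ i ∈ Finset.range n, SteinIG.zVec f (X i ω))
          - SteinIG.meanVec μ lam f))
      atTop
      (id : EuclideanSpace ℝ (Fin 5) → EuclideanSpace ℝ (Fin 5))
      (fun _ => P)
      (multivariateGaussian 0 (SteinIG.covMat μ lam f)) := by
  -- The density's normalization is not computed: it is inherited from `P` through the law of `X 0`.
  have : IsProbabilityMeasure (SteinIG.igMeasure μ lam) :=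
    (hlaw 0).isProbabilityMeasure_iff.1 inferInstance
  have hZ := SteinIG.memLp_zVec hμ hlam hf.continuousOn h020 h420 h402
  have hmeas := hZ.aestronglyMeasurable.aemeasurable
  have hZm (i : ℕ) : AEMeasurable (SteinIG.zVec f) (P.map (X i)) := by
    rwa [(hlaw i).map_eq]
  have hmem (i : ℕ) : MemLp (fun ω => SteinIG.zVec f (X i ω)) 2 P := by
    have h : MemLp (SteinIG.zVec f) 2 (P.map (X i)) := by rwa [(hlaw i).map_eq]
    exact (memLp_map_measure_iff h.aestronglyMeasurable (hlaw i).aemeasurable).1 h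
  have hmean (i : ℕ) : ∫ ω, SteinIG.zVec f (X i ω) ∂P = SteinIG.meanVec μ lam f := by
    have h := (hlaw i).integral_comp hZ.aestronglyMeasurable
    rw [Function.comp_def] at h
    rw [h]
    ext a
    rw [eval_integral_piLp (fun a => (hZ.eval_piLp a).integrable (by norm_num)),
      SteinIG.integral_zVec_apply hμ]
  have hcov (i : ℕ) (a b : Fin 5) :
      cov[fun ω => SteinIG.zVec f (X i ω) a, fun ω => SteinIG.zVec f (X i ω) b; P]
        = SteinIG.covMat μ lam f a b := by
    rw [← SteinIG.covariance_zVec hμ hlam hZ]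
    exact (hlaw i).covariance_fun_comp (hZ.eval_piLp a).aestronglyMeasurable.aemeasurable
      (hZ.eval_piLp b).aestronglyMeasurable.aemeasurable
  have hident (i : ℕ) : IdentDistrib (fun ω => SteinIG.zVec f (X i ω))
      (fun ω => SteinIG.zVec f (X 0 ω)) P P := by
    have h : IdentDistrib (X i) (X 0) P P :=
      ⟨(hlaw i).aemeasurable, (hlaw 0).aemeasurable, (hlaw i).map_eq.trans (hlaw 0).map_eq.symm⟩
    exact h.comp_of_aemeasurable (hZm i)
  refine ⟨hmem, hmean, hcov, SteinIG.posSemidef_of_covariance_eq (hmem 0) (hcov 0), ?_⟩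
  have clt := SteinIG.tendstoInDistribution_multivariateGaussian (hmem 0)
    (hindep.comp₀ (fun _ => SteinIG.zVec f) (fun i => (hlaw i).aemeasurable) hZm) hident (hcov 0)
  refine clt.congr (fun n => ae_of_all _ fun ω => ?_) (ae_eq_refl _)
  simp only [hmean, Function.comp_apply]
  -- At `n = 0` both normalizations vanish, as `√0 = 0` and `0⁻¹ = 0`.
  rcases Nat.eq_zero_or_pos n with rfl | hn
  · simp
  · have hn' : (0 : ℝ) < n := by exact_mod_cast hn
    have h1 : √(n : ℝ) * (n : ℝ)⁻¹ = (√(n : ℝ))⁻¹ := by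
      rw [← div_eq_mul_inv, Real.sqrt_div_self', one_div]
    have h2 : (√(n : ℝ))⁻¹ * n = √(n : ℝ) := by
      rw [← h1, mul_assoc, inv_mul_cancel₀ hn'.ne', mul_one]
    rw [smul_sub, smul_sub, smul_smul, smul_smul, h1, h2]
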